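/- Let $n\ge 1$ and let $P\subset\mathbb{R}^d$ be a centrally symmetric polytope whose vertices are $\pm v_1,\dots,\pm v_n$, and let $\ell:\mathbb{R}^d\to\mathbb{R}$ be a linear functional with $0<\ell(v_1)<\dots<\ell(v_n)$. For $1\le i\le n$ put $a_i=\ell(v_i)$, $v_{-i}=-v_i$ and $a_{-i}=-a_i$. Let $$MPP_\ell(P)=\operatorname{conv}\left\{\frac{1}{\operatorname{length}(\ell(P))}\int_{\ell(P)}s(x)\,dx \;:\; s:\ell(P)\to P \text{ continuous},\ \ell(s(x))=x \text{ for all } x\in\ell(P)\right\}$$ be the monotone path polytope of $P$ with respect to $\ell$. Then $$MPP_\ell(P)=\operatorname{conv}\left\{-\frac{a_{i_1}+a_{i_k}}{4a_n}\,v_n+\sum_{j=1}^{k}\frac{a_{i_{j+1}}-a_{i_{j-1}}}{4a_n}\,v_{i_j}\right\},$$ where the set on the right runs over all $k\ge 0$ and all sequences of integers $-n=i_0<i_1<\dots<i_k<i_{k+1}=n$ with $i_a\ne -i_b$ for all $a,b\in\{1,\dots,k\}$ (taking $a=b$, in particular no $i_a$ is $0$). -/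

import Mathlib

open scoped Pointwise

/-- A polytope in `ℝ^d`: the convex hull of a finite set of points. -/
def IsPolytope {d : ℕ} (P : Set (EuclideanSpace ℝ (Fin d))) : Prop :=
  ∃ S : Set (EuclideanSpace ℝ (Fin d)), S.Finite ∧ P = convexHull ℝ S

/-- `s` is a (continuous) section of the projection `ℓ : P → ℓ(P)`. Only the values of `s` on the
interval `ℓ(P)` matter. -/
def IsSectionOf {d : ℕ} (P : Set (EuclideanSpace ℝ (Fin d)))
    (ℓ : EuclideanSpace ℝ (Fin d) →ₗ[ℝ] ℝ) (s : ℝ → EuclideanSpace ℝ (Fin d)) : Prop :=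
  ContinuousOn s (ℓ '' P) ∧ ∀ t ∈ ℓ '' P, s t ∈ P ∧ ℓ (s t) = t

/-- The monotone path polytope of `P` with respect to `ℓ`, that is, the fiber polytope of
`ℓ : P → ℓ(P)`: the convex hull of the integrals of the sections of `ℓ`, divided by the length of
the interval `ℓ(P)` (so that it consists of average values of sections). -/
noncomputable def monotonePathPolytope {d : ℕ} (P : Set (EuclideanSpace ℝ (Fin d)))
    (ℓ : EuclideanSpace ℝ (Fin d) →ₗ[ℝ] ℝ) : Set (EuclideanSpace ℝ (Fin d)) :=
  (MeasureTheory.volume.real (ℓ '' P))⁻¹ •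
    convexHull ℝ {y | ∃ s : ℝ → EuclideanSpace ℝ (Fin d),
      IsSectionOf P ℓ s ∧ y = ∫ t in ℓ '' P, s t}

/-- The vector `v_i` for a signed index `i`, with the convention `v_{-i} = -v_i` for `i > 0`
(and `0` for the index `0`). -/
def signedVertex {d : ℕ} (v : ℕ → EuclideanSpace ℝ (Fin d)) (i : ℤ) : EuclideanSpace ℝ (Fin d) :=
  i.sign • v i.natAbs

/-- The sequence `-n = i_0 < i_1 < ⋯ < i_k < i_{k+1} = n` of integers has `i_a ≠ -i_b` for all
`a, b ∈ {1, …, k}` (for `a = b` this says that the index `0` is not used). The values of `i` beyond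
`k + 1` are irrelevant. -/
def IsAntipodeFree (n k : ℕ) (i : ℕ → ℤ) : Prop :=
  i 0 = -(n : ℤ) ∧ i (k + 1) = (n : ℤ) ∧ StrictMonoOn i (Set.Icc 0 (k + 1)) ∧
    ∀ a ∈ Set.Icc 1 k, ∀ b ∈ Set.Icc 1 k, i a ≠ -i b

/-- With `a_i = ℓ(v_i)` for signed indices `i`, the vector
`-(a_{i_1} + a_{i_k}) / (4 a_n) · v_n + ∑_{j=1}^k (a_{i_{j+1}} - a_{i_{j-1}}) / (4 a_n) · v_{i_j}`. -/
noncomputable def averagedPathVector {d : ℕ} (v : ℕ → EuclideanSpace ℝ (Fin d))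
    (ℓ : EuclideanSpace ℝ (Fin d) →ₗ[ℝ] ℝ) (n k : ℕ) (i : ℕ → ℤ) : EuclideanSpace ℝ (Fin d) :=
  (-((ℓ (signedVertex v (i 1)) + ℓ (signedVertex v (i k))) / (4 * ℓ (v n)))) • v n +
    ∑ j ∈ Finset.Icc 1 k,
      ((ℓ (signedVertex v (i (j + 1))) - ℓ (signedVertex v (i (j - 1)))) / (4 * ℓ (v n))) •
        signedVertex v (i j)

/-! Along a monotone vertex path, linear interpolation is a section of `ℓ`, and the trapezoid rule
gives its average as `averagedPathVector`; this yields one inclusion. For the other, a section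
average outside the finite, hence closed, hull would be separated from it by a functional `f`.
Subtracting a multiple of `ℓ`, which changes `f` equally on all sections, gives `g` with `g (v n) =
0`. The upper hull of the planar points `(ℓ (±v_i), g (±v_i))` maximizes `g` on every fibre at once
(`exists_vertexPath_ge`). Its end points have height 0, so by concavity its inner vertices can be
chosen at positive height (`exists_upper_hull`). As `g` is odd, no two of them are antipodal: the
maximizing path is antipode-free, contradicting the separation. -/

open MeasureTheory

/-! ### Polygonal paths and their integrals -/

section PolygonalPath

variable {E : Type*} [NormedAddCommGroup E] [NormedSpace ℝ E]

/-- The polygonal path through the points `V 0, …, V N`, passing through `V m` at time `A m`, and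
constant before `A 0` and after `A N`. -/
noncomputable def polygonalPath (A : ℕ → ℝ) (V : ℕ → E) (N : ℕ) (t : ℝ) : E :=
  V 0 + ∑ m ∈ Finset.range N, max 0 (min 1 ((t - A m) / (A (m + 1) - A m))) • (V (m + 1) - V m)

theorem continuous_polygonalPath (A : ℕ → ℝ) (V : ℕ → E) (N : ℕ) :
    Continuous (polygonalPath A V N) := by
  unfold polygonalPath
  fun_prop

theorem le_of_forall_lt_succ {A : ℕ → ℝ} {N : ℕ} (hA : ∀ m < N, A m < A (m + 1)) {p q : ℕ}
    (hpq : p ≤ q) (hq : q ≤ N) : A p ≤ A q := by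
  induction q, hpq using Nat.le_induction with
  | base => exact le_rfl
  | succ q _ ih => exact (ih (by omega)).trans (hA q (by omega)).le

/-- On the `m`-th interval the earlier clamped ramps equal 1 and telescope to `V m - V 0`, while the
later ones vanish. -/
theorem polygonalPath_eq {A : ℕ → ℝ} (V : ℕ → E) {N : ℕ} (hA : ∀ m < N, A m < A (m + 1))
    {m : ℕ} (hm : m < N) {t : ℝ} (ht : t ∈ Set.Icc (A m) (A (m + 1))) :
    polygonalPath A V N t = V m + ((t - A m) / (A (m + 1) - A m)) • (V (m + 1) - V m) := by
  have key : ∀ M, m + 1 ≤ M → M ≤ N →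
      polygonalPath A V M t = V m + ((t - A m) / (A (m + 1) - A m)) • (V (m + 1) - V m) := by
    intro M hM
    induction M, hM using Nat.le_induction with
    | base =>
      intro _
      have h1 : ∑ p ∈ Finset.range m,
          max 0 (min 1 ((t - A p) / (A (p + 1) - A p))) • (V (p + 1) - V p) = V m - V 0 := by
        rw [← Finset.sum_range_sub]
        refine Finset.sum_congr rfl fun p hp => ?_
        rw [Finset.mem_range] at hp
        have h2 := hA p (by omega)
        have h3 : A (p + 1) ≤ A m := le_of_forall_lt_succ hA hp hm.le
        have h4 : 1 ≤ (t - A p) / (A (p + 1) - A p) := by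
          rw [le_div_iff₀ (by linarith)]
          linarith [ht.1]
        rw [min_eq_left h4, max_eq_right zero_le_one, one_smul]
      have h2 := hA m hm
      have h5 : 0 ≤ (t - A m) / (A (m + 1) - A m) :=
        div_nonneg (by linarith [ht.1]) (by linarith)
      have h6 : (t - A m) / (A (m + 1) - A m) ≤ 1 := by
        rw [div_le_one (by linarith)]
        linarith [ht.2]
      rw [polygonalPath, Finset.sum_range_succ, h1, min_eq_right h6, max_eq_right h5]
      abel
    | succ M hM ih =>
      intro hMN
      have h2 := hA M (by omega)
      have h3 : A (m + 1) ≤ A M := le_of_forall_lt_succ hA hM (by omega)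
      have h4 : (t - A M) / (A (M + 1) - A M) ≤ 0 :=
        div_nonpos_of_nonpos_of_nonneg (by linarith [ht.2]) (by linarith)
      rw [← ih (by omega), polygonalPath, Finset.sum_range_succ,
        max_eq_left ((min_le_right _ _).trans h4), zero_smul, add_zero, polygonalPath]
  exact key N hm le_rfl

theorem exists_mem_Icc_succ (A : ℕ → ℝ) {N : ℕ} (hN : 0 < N) {t : ℝ}
    (ht : t ∈ Set.Icc (A 0) (A N)) : ∃ m < N, t ∈ Set.Icc (A m) (A (m + 1)) := by
  induction N, hN using Nat.le_induction with
  | base => exact ⟨0, by omega, ht⟩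
  | succ N hN ih =>
    rcases le_total t (A N) with h | h
    · obtain ⟨m, hm, hmt⟩ := ih ⟨ht.1, h⟩
      exact ⟨m, by omega, hmt⟩
    · exact ⟨N, by omega, h, ht.2⟩

theorem integral_segment [CompleteSpace E] {a b : ℝ} (hab : a < b) (x y : E) :
    ∫ t in a..b, (x + ((t - a) / (b - a)) • (y - x)) = ((b - a) / 2) • (x + y) := by
  have hc : Continuous fun t : ℝ => ((t - a) / (b - a)) • (y - x) := by fun_prop
  rw [intervalIntegral.integral_add (by simp) (hc.intervalIntegrable _ _),
    intervalIntegral.integral_const, intervalIntegral.integral_smul_const]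
  have h : ∫ t in a..b, (t - a) / (b - a) = (b - a) / 2 := by
    rw [intervalIntegral.integral_div, intervalIntegral.integral_sub (by simp) (by simp),
      integral_id, intervalIntegral.integral_const, smul_eq_mul]
    have : b - a ≠ 0 := by linarith
    field_simp
    ring
  rw [h]
  module

theorem integral_polygonalPath [CompleteSpace E] {A : ℕ → ℝ} (V : ℕ → E) {N : ℕ}
    (hA : ∀ m < N, A m < A (m + 1)) :
    ∫ t in A 0..A N, polygonalPath A V N t =
      ∑ m ∈ Finset.range N, ((A (m + 1) - A m) / 2) • (V m + V (m + 1)) := by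
  rw [← intervalIntegral.sum_integral_adjacent_intervals fun m _ =>
    (continuous_polygonalPath A V N).intervalIntegrable _ _]
  refine Finset.sum_congr rfl fun m hm => ?_
  rw [Finset.mem_range] at hm
  rw [← integral_segment (hA m hm)]
  refine intervalIntegral.integral_congr fun t ht => ?_
  rw [Set.uIcc_of_le (hA m hm).le] at ht
  exact polygonalPath_eq V hA hm ht

/-- Summation by parts: an inner vertex collects half of each adjacent interval, whence the
differences `a_{i_{j+1}} - a_{i_{j-1}}`. -/
theorem sum_trapezoids_eq (A : ℕ → ℝ) (V : ℕ → E) (k : ℕ) :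
    ∑ m ∈ Finset.range (k + 1), ((A (m + 1) - A m) / 2) • (V m + V (m + 1)) =
      ((A 1 - A 0) / 2) • V 0 + ∑ j ∈ Finset.Icc 1 k, ((A (j + 1) - A (j - 1)) / 2) • V j +
        ((A (k + 1) - A k) / 2) • V (k + 1) := by
  induction k with
  | zero => simp
  | succ k ih =>
    rw [Finset.sum_range_succ, ih, Finset.sum_Icc_succ_top (by omega)]
    simp only [Nat.add_sub_cancel]
    module

end PolygonalPath

/-! ### Upper hulls of finite planar point sets -/

section UpperHull

variable {J : Finset ℤ} {n : ℤ} {a y : ℤ → ℝ}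

/-- The line through the points `(a i, y i)` and `(a j, y j)` lies above all the points indexed by
`J`. -/
def IsUpperEdge (J : Finset ℤ) (a y : ℤ → ℝ) (i j : ℤ) : Prop :=
  ∀ l ∈ J, y l * (a j - a i) ≤ y i * (a j - a l) + y j * (a l - a i)

/-- Gift wrapping: `j` maximizes the slope seen from `i`. -/
theorem exists_next_hull_index (hn : n ∈ J) (ha : StrictMonoOn a J) {i : ℤ} (hi : i ∈ J)
    (hin : i < n) : ∃ j ∈ J, i < j ∧
      ∀ l ∈ J, i < l → y l * (a j - a i) ≤ y i * (a j - a l) + y j * (a l - a i) := by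
  obtain ⟨j, hj, hmax⟩ := (J.filter (i < ·)).exists_max_image
    (fun l => (y l - y i) / (a l - a i)) ⟨n, by simp [hn, hin]⟩
  rw [Finset.mem_filter] at hj
  refine ⟨j, hj.1, hj.2, fun l hl hil => ?_⟩
  have h := hmax l (by simp [hl, hil])
  have h1 := ha hi hj.1 hj.2
  have h2 := ha hi hl hil
  rw [div_le_div_iff₀ (by linarith) (by linarith)] at h
  linarith

/-- Induction on the distance to `n`. The slope `σ` of a supporting line at `i` records that `i` is
on the hull; each new edge supplies such a line at its right end. -/
theorem exists_upper_hull_from (hn : n ∈ J) (hJ : ∀ i ∈ J, i ≤ n) (ha : StrictMonoOn a J)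
    (hyn : y n = 0) : ∀ (N : ℕ) (i : ℤ), (n - i).toNat = N → i ∈ J → i < n → 0 < y i →
      (∃ σ : ℝ, ∀ l ∈ J, y l ≤ y i + σ * (a l - a i)) →
      ∃ (k : ℕ) (q : ℕ → ℤ), q 0 = i ∧ q (k + 1) = n ∧ (∀ m ≤ k, q m < q (m + 1)) ∧
        (∀ m ≤ k, q m ∈ J) ∧ (∀ m ≤ k, 0 < y (q m)) ∧
        ∀ m ≤ k, IsUpperEdge J a y (q m) (q (m + 1)) := by
  intro N
  induction N using Nat.strong_induction_on with
  | _ N ih =>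
    intro i hN hi hin hyi ⟨σ, hσ⟩
    obtain ⟨j, hj, hij, hmax⟩ := exists_next_hull_index (y := y) hn ha hi hin
    have haij := ha hi hj hij
    have hedge : IsUpperEdge J a y i j := by
      intro l hl
      rcases lt_trichotomy l i with h | h | h
      -- Since `j` lies below the supporting line, the edge has slope at most `σ`, so left of `i` it
      -- runs above that line.
      · have h1 := ha hl hi h
        have h2 := hσ l hl
        have h3 := hσ j hj
        nlinarith [mul_le_mul_of_nonneg_right h2 (sub_nonneg.2 haij.le),
          mul_le_mul_of_nonneg_right h3 (sub_nonneg.2 h1.le)]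
      · subst h
        linarith
      · exact hmax l hl h
    rcases (hJ j hj).eq_or_lt with rfl | hjn
    · refine ⟨0, fun m => if m = 0 then i else j, by simp, by simp, ?_, ?_, ?_, ?_⟩ <;>
        intro m hm <;> obtain rfl : m = 0 := by omega
      all_goals simpa
    · have hajn := ha hj hn hjn
      -- The edge line is positive at `i` and nonnegative at `n`, hence positive at `j` between
      -- them.
      have hyj : 0 < y j := by
        have h := hedge n hn
        rw [hyn] at h
        have : 0 < y j * (a n - a i) := by nlinarith
        exact pos_of_mul_pos_left this (by linarith)
      obtain ⟨k, q, h0, hk, hlt, hmem, hpos, he⟩ := ih (n - j).toNat (by omega) j rfl hj hjn hyj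
        ⟨(y j - y i) / (a j - a i), fun l hl => by
          have h := hedge l hl
          have hd : 0 < a j - a i := by linarith
          rw [div_mul_eq_mul_div, ← sub_le_iff_le_add', le_div_iff₀ hd]
          linarith⟩
      refine ⟨k + 1, fun m => if m = 0 then i else q (m - 1), by simp, by simpa, ?_, ?_, ?_, ?_⟩ <;>
        rintro (_ | m) hm
      · simpa [h0]
      · simpa using hlt m (by omega)
      · simpa
      · simpa using hmem m (by omega)
      · simpa
      · simpa using hpos m (by omega)
      · simpa [h0]
      · simpa using he m (by omega)

/-- The upper hull of finitely many points of the plane, where the leftmost and the rightmost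
point are at height `0`, and the vertices in between are at positive height. -/
theorem exists_upper_hull {i : ℤ} (hi : i ∈ J) (hiJ : ∀ j ∈ J, i ≤ j) (hin : i < n) (hn : n ∈ J)
    (hJ : ∀ j ∈ J, j ≤ n) (ha : StrictMonoOn a J) (hyi : y i = 0) (hyn : y n = 0) :
    ∃ (k : ℕ) (q : ℕ → ℤ), q 0 = i ∧ q (k + 1) = n ∧ (∀ m ≤ k, q m < q (m + 1)) ∧
      (∀ m ≤ k, q m ∈ J) ∧ (∀ m ∈ Set.Icc 1 k, 0 < y (q m)) ∧
      ∀ m ≤ k, IsUpperEdge J a y (q m) (q (m + 1)) := by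
  have hain := ha hi hn hin
  -- With no point above height 0 the single edge from `i` to `n` suffices; otherwise the first edge
  -- has positive slope.
  by_cases hneg : ∀ j ∈ J, y j ≤ 0
  · refine ⟨0, fun m => if m = 0 then i else n, by simp, by simp, ?_, ?_, by simp, ?_⟩ <;>
      intro m hm <;> obtain rfl : m = 0 := by omega
    · simpa
    · simpa
    · intro l hl
      simp only [if_true, zero_add, one_ne_zero, if_false, hyi, hyn]
      nlinarith [hneg l hl]
  · push Not at hneg
    obtain ⟨p, hp, hyp⟩ := hneg
    have hip : i < p := (hiJ p hp).lt_of_ne (by rintro rfl; linarith)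
    have haip := ha hi hp hip
    obtain ⟨j, hj, hij, hmax⟩ := exists_next_hull_index (y := y) hn ha hi hin
    have haij := ha hi hj hij
    have hedge : IsUpperEdge J a y i j := by
      intro l hl
      rcases (hiJ l hl).eq_or_lt with rfl | h
      · linarith
      · exact hmax l hl h
    have hyj : 0 < y j := by
      have h := hedge p hp
      rw [hyi, zero_mul, zero_add] at h
      have : 0 < y j * (a p - a i) := lt_of_lt_of_le (mul_pos hyp (by linarith)) h
      exact pos_of_mul_pos_left this (by linarith)
    have hjn : j < n := (hJ j hj).lt_of_ne (by rintro rfl; linarith)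
    obtain ⟨k, q, h0, hk, hlt, hmem, hpos, he⟩ :=
      exists_upper_hull_from hn hJ ha hyn _ j rfl hj hjn hyj
        ⟨(y j - y i) / (a j - a i), fun l hl => by
          have h := hedge l hl
          have hd : 0 < a j - a i := by linarith
          rw [div_mul_eq_mul_div, ← sub_le_iff_le_add', le_div_iff₀ hd]
          linarith⟩
    refine ⟨k + 1, fun m => if m = 0 then i else q (m - 1), by simp, by simpa, ?_, ?_, ?_, ?_⟩ <;>
      rintro (_ | m) hm
    · simpa [h0]
    · simpa using hlt m (by omega)
    · simpa
    · simpa using hmem m (by omega)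
    · simp at hm
    · simpa using hpos m (by simpa using hm.2)
    · simpa [h0]
    · simpa using he m (by omega)

end UpperHull

/-! ### Signed indices of the vertices -/

section SignedVertex

variable {d n : ℕ} {P : Set (EuclideanSpace ℝ (Fin d))} {v : ℕ → EuclideanSpace ℝ (Fin d)}
  {ℓ : EuclideanSpace ℝ (Fin d) →ₗ[ℝ] ℝ}

/-- The signed indices of the vertices `±v_1, …, ±v_n`. -/
noncomputable def signedIndices (n : ℕ) : Finset ℤ := (Finset.Icc (-(n : ℤ)) n).erase 0

theorem mem_signedIndices {i : ℤ} : i ∈ signedIndices n ↔ i ≠ 0 ∧ -(n : ℤ) ≤ i ∧ i ≤ n := by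
  simp [signedIndices]

theorem signedVertex_neg (v : ℕ → EuclideanSpace ℝ (Fin d)) (i : ℤ) :
    signedVertex v (-i) = -signedVertex v i := by
  simp [signedVertex]

theorem signedVertex_natCast (v : ℕ → EuclideanSpace ℝ (Fin d)) {m : ℕ} (hm : 1 ≤ m) :
    signedVertex v (m : ℤ) = v m := by
  rw [signedVertex, Int.sign_eq_one_of_pos (by omega), one_smul, Int.natAbs_natCast]

theorem extremePoints_eq_image_signedVertex
    (hv : P.extremePoints ℝ = {x | ∃ i ∈ Set.Icc 1 n, x = v i ∨ x = -v i}) :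
    P.extremePoints ℝ = signedVertex v '' signedIndices n := by
  rw [hv]
  ext x
  constructor
  · rintro ⟨i, hi, rfl | rfl⟩
    · exact ⟨i, mem_signedIndices.2 (by have := hi.1; have := hi.2; omega),
        signedVertex_natCast v hi.1⟩
    · exact ⟨-i, mem_signedIndices.2 (by have := hi.1; have := hi.2; omega), by
        rw [signedVertex_neg, signedVertex_natCast v hi.1]⟩
  · rintro ⟨i, hi, rfl⟩
    have hi := mem_signedIndices.1 hi
    rcases le_total 0 i with h | h
    · lift i to ℕ using h
      exact ⟨i, ⟨by omega, by omega⟩, Or.inl (signedVertex_natCast v (by omega))⟩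
    · obtain ⟨m, rfl⟩ := Int.exists_eq_neg_ofNat h
      exact ⟨m, ⟨by omega, by omega⟩, Or.inr (by
        rw [signedVertex_neg, signedVertex_natCast v (by omega)])⟩

theorem strictMonoOn_signedVertex (hpos : 0 < ℓ (v 1))
    (hmono : StrictMonoOn (fun i => ℓ (v i)) (Set.Icc 1 n)) :
    StrictMonoOn (fun i => ℓ (signedVertex v i)) (signedIndices n) := by
  have hp : ∀ m : ℕ, 1 ≤ m → m ≤ n → 0 < ℓ (v m) := fun m h1 h2 =>
    hpos.trans_le (hmono.monotoneOn ⟨le_rfl, h1.trans h2⟩ ⟨h1, h2⟩ h1)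
  intro i hi j hj hij
  have hi := mem_signedIndices.1 hi
  have hj := mem_signedIndices.1 hj
  dsimp only
  rcases le_total 0 i with h | h
  · lift i to ℕ using h
    lift j to ℕ using (by omega)
    rw [signedVertex_natCast v (by omega), signedVertex_natCast v (by omega)]
    exact hmono ⟨by omega, by omega⟩ ⟨by omega, by omega⟩ (by omega)
  · obtain ⟨p, rfl⟩ := Int.exists_eq_neg_ofNat h
    rw [signedVertex_neg, signedVertex_natCast v (by omega), map_neg]
    have h1 := hp p (by omega) (by omega)
    rcases le_total 0 j with h' | h'
    · lift j to ℕ using h'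
      rw [signedVertex_natCast v (by omega)]
      have h2 := hp j (by omega) (by omega)
      linarith
    · obtain ⟨q, rfl⟩ := Int.exists_eq_neg_ofNat h'
      rw [signedVertex_neg, signedVertex_natCast v (by omega), map_neg, neg_lt_neg_iff]
      exact hmono ⟨by omega, by omega⟩ ⟨by omega, by omega⟩ (by omega)

end SignedVertex

/-! ### Finiteness of the set of path vectors -/

section AntipodeFree

variable {n k : ℕ} {i : ℕ → ℤ}

theorem IsAntipodeFree.mem_signedIndices (hn : 1 ≤ n) (h : IsAntipodeFree n k i) {m : ℕ}
    (hm : m ≤ k + 1) : i m ∈ signedIndices n := by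
  obtain ⟨h0, hk, hmono, hfree⟩ := h
  have h1 := hmono.monotoneOn ⟨le_rfl, by omega⟩ ⟨by omega, hm⟩ (Nat.zero_le m)
  have h2 := hmono.monotoneOn ⟨by omega, hm⟩ ⟨by omega, le_rfl⟩ hm
  refine _root_.mem_signedIndices.2 ⟨?_, by omega, by omega⟩
  rcases Nat.eq_zero_or_pos m with rfl | hm0
  · omega
  · rcases hm.eq_or_lt with rfl | hmk
    · omega
    · have := hfree m ⟨hm0, by omega⟩ m ⟨hm0, by omega⟩
      omega

theorem IsAntipodeFree.le (h : IsAntipodeFree n k i) : k ≤ 2 * n := by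
  obtain ⟨h0, hk, hmono, -⟩ := h
  have key : ∀ m ≤ k + 1, -(n : ℤ) + m ≤ i m := by
    intro m
    induction m with
    | zero => intro _; simp [h0]
    | succ m ih =>
      intro hm
      have h1 := ih (by omega)
      have h2 := hmono ⟨Nat.zero_le m, by omega⟩ ⟨by omega, hm⟩ (Nat.lt_succ_self m)
      push_cast
      omega
  have := key (k + 1) le_rfl
  push_cast at this
  omega

theorem finite_averagedPathVectors {d : ℕ} (v : ℕ → EuclideanSpace ℝ (Fin d))
    (ℓ : EuclideanSpace ℝ (Fin d) →ₗ[ℝ] ℝ) (hn : 1 ≤ n) :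
    {x | ∃ (k : ℕ) (i : ℕ → ℤ),
      IsAntipodeFree n k i ∧ x = averagedPathVector v ℓ n k i}.Finite := by
  refine (Set.finite_range fun p : Fin (2 * n + 1) × (Fin (2 * n + 2) → signedIndices n) =>
    averagedPathVector v ℓ n p.1 fun m => if h : m < 2 * n + 2 then p.2 ⟨m, h⟩ else 0).subset ?_
  rintro x ⟨k, i, h, rfl⟩
  have hk := h.le
  -- Values of `i` beyond `k + 1` are unconstrained; freezing them at `i (k + 1)` keeps them in
  -- `signedIndices n`.
  refine ⟨(⟨k, by omega⟩, fun m => ⟨i (min m (k + 1)), h.mem_signedIndices hn (by omega)⟩), ?_⟩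
  have hi : ∀ m ≤ k + 1, (if m < 2 * n + 2 then i (min m (k + 1)) else 0) = i m := by
    intro m hm
    rw [if_pos (by omega), min_eq_left hm]
  simp only [averagedPathVector, dite_eq_ite]
  rw [hi 1 (by omega), hi k (by omega)]
  congr 1
  refine Finset.sum_congr rfl fun j hj => ?_
  rw [Finset.mem_Icc] at hj
  rw [hi _ (by omega), hi _ (by omega), hi _ (by omega)]

end AntipodeFree

/-! ### Sections along vertex paths and their optimality -/

section MonotonePaths

variable {d n : ℕ} {P : Set (EuclideanSpace ℝ (Fin d))} {v : ℕ → EuclideanSpace ℝ (Fin d)}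
  {ℓ : EuclideanSpace ℝ (Fin d) →ₗ[ℝ] ℝ}

/-- Krein–Milman; the closure is superfluous for a finite set of extreme points. -/
theorem IsPolytope.eq_convexHull_extremePoints (hP : IsPolytope P)
    (hfin : (P.extremePoints ℝ).Finite) : P = convexHull ℝ (P.extremePoints ℝ) := by
  obtain ⟨S, hS, rfl⟩ := hP
  have h := closure_convexHull_extremePoints (hS.isCompact_convexHull (𝕜 := ℝ))
    (convex_convexHull ℝ S)
  rwa [(hfin.isClosed_convexHull (𝕜 := ℝ)).closure_eq, eq_comm] at h

theorem image_eq_Icc (hn : 1 ≤ n)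
    (hconv : P = convexHull ℝ (signedVertex v '' signedIndices n))
    (hmono : StrictMonoOn (fun i => ℓ (signedVertex v i)) (signedIndices n)) :
    ℓ '' P = Set.Icc (-ℓ (v n)) (ℓ (v n)) := by
  have hn1 : (n : ℤ) ∈ signedIndices n := mem_signedIndices.2 (by omega)
  have hn2 : -(n : ℤ) ∈ signedIndices n := mem_signedIndices.2 (by omega)
  have e1 : ℓ (signedVertex v n) = ℓ (v n) := by rw [signedVertex_natCast v hn]
  have e2 : ℓ (signedVertex v (-n)) = -ℓ (v n) := by
    rw [signedVertex_neg, signedVertex_natCast v hn, map_neg]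
  rw [hconv, ℓ.image_convexHull]
  apply Set.Subset.antisymm
  · refine convexHull_min ?_ (convex_Icc _ _)
    rintro _ ⟨_, ⟨i, hi, rfl⟩, rfl⟩
    have hi' := mem_signedIndices.1 hi
    rw [← e2, ← e1]
    exact ⟨hmono.monotoneOn hn2 hi hi'.2.1, hmono.monotoneOn hi hn1 hi'.2.2⟩
  · have h12 : -ℓ (v n) ≤ ℓ (v n) := by
      rw [← e2, ← e1]
      exact hmono.monotoneOn hn2 hn1 (by omega)
    rw [← segment_eq_Icc h12]
    refine segment_subset_convexHull ?_ ?_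
    · exact ⟨_, ⟨_, hn2, rfl⟩, e2⟩
    · exact ⟨_, ⟨_, hn1, rfl⟩, e1⟩

/-- The section of `ℓ` that follows the monotone path through the vertices of an antipode-free
sequence. -/
noncomputable def vertexPath (v : ℕ → EuclideanSpace ℝ (Fin d))
    (ℓ : EuclideanSpace ℝ (Fin d) →ₗ[ℝ] ℝ) (k : ℕ) (i : ℕ → ℤ) : ℝ → EuclideanSpace ℝ (Fin d) :=
  polygonalPath (fun m => ℓ (signedVertex v (i m))) (fun m => signedVertex v (i m)) (k + 1)

variable {k : ℕ} {i : ℕ → ℤ}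

theorem IsAntipodeFree.lt_succ (hn : 1 ≤ n) (h : IsAntipodeFree n k i)
    (hmono : StrictMonoOn (fun i => ℓ (signedVertex v i)) (signedIndices n)) :
    ∀ m < k + 1, ℓ (signedVertex v (i m)) < ℓ (signedVertex v (i (m + 1))) := fun m hm =>
  hmono (h.mem_signedIndices hn (by omega)) (h.mem_signedIndices hn (by omega))
    (h.2.2.1 ⟨by omega, by omega⟩ ⟨by omega, by omega⟩ (by omega))

theorem IsAntipodeFree.signedVertex_zero (hn : 1 ≤ n) (h : IsAntipodeFree n k i) :
    signedVertex v (i 0) = -v n := by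
  rw [h.1, signedVertex_neg, signedVertex_natCast v hn]

theorem IsAntipodeFree.signedVertex_last (hn : 1 ≤ n) (h : IsAntipodeFree n k i) :
    signedVertex v (i (k + 1)) = v n := by
  rw [h.2.1, signedVertex_natCast v hn]

theorem exists_edge (hn : 1 ≤ n) (h : IsAntipodeFree n k i) {t : ℝ}
    (ht : t ∈ Set.Icc (-ℓ (v n)) (ℓ (v n))) :
    ∃ m < k + 1, t ∈ Set.Icc (ℓ (signedVertex v (i m))) (ℓ (signedVertex v (i (m + 1)))) := by
  refine exists_mem_Icc_succ (fun m => ℓ (signedVertex v (i m))) (Nat.succ_pos k) ?_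
  rwa [h.signedVertex_zero hn, Nat.succ_eq_add_one, h.signedVertex_last hn, map_neg]

theorem isSectionOf_vertexPath (hn : 1 ≤ n)
    (hconv : P = convexHull ℝ (signedVertex v '' signedIndices n))
    (hmono : StrictMonoOn (fun i => ℓ (signedVertex v i)) (signedIndices n))
    (h : IsAntipodeFree n k i) : IsSectionOf P ℓ (vertexPath v ℓ k i) := by
  refine ⟨(continuous_polygonalPath _ _ _).continuousOn, fun t ht => ?_⟩
  rw [image_eq_Icc hn hconv hmono] at ht
  obtain ⟨m, hm, hmt⟩ := exists_edge hn h ht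
  have hlt := h.lt_succ hn hmono
  have hlm := hlt m hm
  have hmem : ∀ m ≤ k + 1, signedVertex v (i m) ∈ P := fun m hm => by
    rw [hconv]
    exact subset_convexHull ℝ _ ⟨_, h.mem_signedIndices hn hm, rfl⟩
  rw [vertexPath, polygonalPath_eq _ hlt hm hmt]
  constructor
  · have hP : Convex ℝ P := by
      rw [hconv]
      exact convex_convexHull ℝ _
    refine hP.add_smul_sub_mem (hmem m (by omega)) (hmem (m + 1) (by omega)) ⟨?_, ?_⟩
    · exact div_nonneg (by linarith [hmt.1]) (by linarith)
    · rw [div_le_one (by linarith)]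
      linarith [hmt.2]
  · rw [map_add, map_smul, map_sub, smul_eq_mul, div_mul_cancel₀ _ (by linarith)]
    ring

/-- The end terms, at `-v n` and `v n`, merge into the single multiple `-(a_{i_1} + a_{i_k}) / 2` of
`v n`. -/
theorem integral_vertexPath (hn : 1 ≤ n) (hvn : 0 < ℓ (v n))
    (hmono : StrictMonoOn (fun i => ℓ (signedVertex v i)) (signedIndices n))
    (h : IsAntipodeFree n k i) :
    ∫ t in Set.Icc (-ℓ (v n)) (ℓ (v n)), vertexPath v ℓ k i t =
      (2 * ℓ (v n)) • averagedPathVector v ℓ n k i := by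
  have hI := integral_polygonalPath (fun m => signedVertex v (i m)) (h.lt_succ hn hmono)
  have hS := sum_trapezoids_eq (fun m => ℓ (signedVertex v (i m))) (fun m => signedVertex v (i m)) k
  simp only [h.signedVertex_zero hn, h.signedVertex_last hn, map_neg] at hI hS
  rw [integral_Icc_eq_integral_Ioc, ← intervalIntegral.integral_of_le (by linarith), vertexPath,
    hI, hS, averagedPathVector, smul_add, Finset.smul_sum]
  have hsum : ∀ j ∈ Finset.Icc 1 k,
      (2 * ℓ (v n)) • ((ℓ (signedVertex v (i (j + 1))) - ℓ (signedVertex v (i (j - 1)))) /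
        (4 * ℓ (v n))) • signedVertex v (i j) =
      ((ℓ (signedVertex v (i (j + 1))) - ℓ (signedVertex v (i (j - 1)))) / 2) •
        signedVertex v (i j) := fun j _ => by
    rw [smul_smul]
    congr 1
    field_simp
    ring
  rw [Finset.sum_congr rfl hsum, smul_smul]
  have hc : 2 * ℓ (v n) * -((ℓ (signedVertex v (i 1)) + ℓ (signedVertex v (i k))) /
      (4 * ℓ (v n))) = -((ℓ (signedVertex v (i 1)) + ℓ (signedVertex v (i k))) / 2) := by
    field_simp
    ring
  rw [hc]
  module

/-- Every linear functional is maximized, over the sections of `ℓ`, by a path through an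
antipode-free sequence of vertices. -/
theorem exists_vertexPath_ge (hn : 1 ≤ n) (hvn : 0 < ℓ (v n))
    (hconv : P = convexHull ℝ (signedVertex v '' signedIndices n))
    (hmono : StrictMonoOn (fun i => ℓ (signedVertex v i)) (signedIndices n))
    (f : EuclideanSpace ℝ (Fin d) →ₗ[ℝ] ℝ) :
    ∃ (k : ℕ) (i : ℕ → ℤ), IsAntipodeFree n k i ∧
      ∀ x ∈ P, f x ≤ f (vertexPath v ℓ k i (ℓ x)) := by
  set g : EuclideanSpace ℝ (Fin d) →ₗ[ℝ] ℝ := f - (f (v n) / ℓ (v n)) • ℓ with hg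
  have hgv : g (v n) = 0 := by
    simp [hg, hvn.ne']
  obtain ⟨k, i, h0, hk, hlt, hmem, hpos, hedge⟩ :=
    exists_upper_hull (J := signedIndices n) (n := n) (i := -(n : ℤ))
      (a := fun i => ℓ (signedVertex v i)) (y := fun i => g (signedVertex v i))
      (mem_signedIndices.2 (by omega)) (fun j hj => (mem_signedIndices.1 hj).2.1) (by omega)
      (mem_signedIndices.2 (by omega)) (fun j hj => (mem_signedIndices.1 hj).2.2) hmono
      (by rw [signedVertex_neg, signedVertex_natCast v hn, map_neg, hgv, neg_zero])
      (by rw [signedVertex_natCast v hn, hgv])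
  have h : IsAntipodeFree n k i := by
    refine ⟨h0, hk, ?_, fun a ha b hb hab => ?_⟩
    · rintro p - q ⟨-, hq⟩ hpq
      induction q, hpq using Nat.le_induction with
      | base => exact hlt p (by omega)
      | succ q _ ih => exact (ih (by omega)).trans (hlt q (by omega))
    -- `g` is odd, so antipodal inner vertices cannot both have positive height.
    · have h1 := hpos a ha
      have h2 := hpos b hb
      rw [hab, signedVertex_neg, map_neg] at h1
      linarith
  refine ⟨k, i, h, fun x hx => ?_⟩
  have hlx : ℓ x ∈ ℓ '' P := ⟨x, hx, rfl⟩
  have hsec := ((isSectionOf_vertexPath hn hconv hmono h).2 _ hlx).2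
  suffices hgx : g x ≤ g (vertexPath v ℓ k i (ℓ x)) by
    simp only [hg, LinearMap.sub_apply, LinearMap.smul_apply, hsec] at hgx
    linarith
  rw [image_eq_Icc hn hconv hmono] at hlx
  obtain ⟨m, hm, hmt⟩ := exists_edge hn h hlx
  have hA := h.lt_succ hn hmono
  have hAm := hA m hm
  rw [vertexPath, polygonalPath_eq _ hA hm hmt]
  set p := signedVertex v (i m)
  set q := signedVertex v (i (m + 1))
  -- Lying below the edge line is a half-space condition, so checking it at the vertices gives it on
  -- all of `P`.
  have hP : P ⊆ {z | ((ℓ q - ℓ p) • g - (g q - g p) • ℓ) z ≤ g p * ℓ q - g q * ℓ p} := by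
    rw [hconv]
    refine convexHull_min ?_ (convex_halfSpace_le (LinearMap.isLinear _) _)
    rintro _ ⟨j, hj, rfl⟩
    have := hedge m (by omega) j hj
    simp only [Set.mem_ofPred_eq, LinearMap.sub_apply, LinearMap.smul_apply, smul_eq_mul]
    linarith
  have hx' := hP hx
  simp only [Set.mem_ofPred_eq, LinearMap.sub_apply, LinearMap.smul_apply, smul_eq_mul] at hx'
  have hd : 0 < ℓ q - ℓ p := by linarith
  rw [map_add, map_smul, map_sub, smul_eq_mul, div_mul_eq_mul_div, ← sub_le_iff_le_add',
    le_div_iff₀ hd]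
  linarith

end MonotonePaths

/-! ### The monotone path polytope -/

theorem corollary1p2 (d n : ℕ) (hn : 1 ≤ n) (P : Set (EuclideanSpace ℝ (Fin d)))
    (hP : IsPolytope P) (v : ℕ → EuclideanSpace ℝ (Fin d))
    (hv : P.extremePoints ℝ = {x | ∃ i ∈ Set.Icc 1 n, x = v i ∨ x = -v i})
    (ℓ : EuclideanSpace ℝ (Fin d) →ₗ[ℝ] ℝ) (hpos : 0 < ℓ (v 1))
    (hmono : StrictMonoOn (fun i => ℓ (v i)) (Set.Icc 1 n)) :
    monotonePathPolytope P ℓ =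
      convexHull ℝ {x | ∃ (k : ℕ) (i : ℕ → ℤ),
        IsAntipodeFree n k i ∧ x = averagedPathVector v ℓ n k i} := by
  have hvn : 0 < ℓ (v n) := hpos.trans_le (hmono.monotoneOn ⟨le_rfl, hn⟩ ⟨hn, le_rfl⟩ hn)
  have hext := extremePoints_eq_image_signedVertex hv
  have hconv : P = convexHull ℝ (signedVertex v '' signedIndices n) := by
    rw [← hext]
    refine hP.eq_convexHull_extremePoints ?_
    rw [hext]
    exact (signedIndices n).finite_toSet.image _
  have hsmono := strictMonoOn_signedVertex hpos hmono
  have himg := image_eq_Icc hn hconv hsmono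
  have hvol : volume.real (ℓ '' P) = 2 * ℓ (v n) := by
    rw [himg, Real.volume_real_Icc_of_le (by linarith)]
    ring
  have hc : 0 < 2 * ℓ (v n) := by linarith
  rw [monotonePathPolytope, hvol, ← convexHull_smul]
  apply Set.Subset.antisymm
  · refine convexHull_min ?_ (convex_convexHull ℝ _)
    rintro _ ⟨_, ⟨s, hs, rfl⟩, rfl⟩
    by_contra hnot
    obtain ⟨f, u, hfu, huf⟩ := geometric_hahn_banach_closed_point (convex_convexHull ℝ _)
      ((finite_averagedPathVectors v ℓ hn).isClosed_convexHull (𝕜 := ℝ)) hnot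
    obtain ⟨k, i, h, hmax⟩ := exists_vertexPath_ge hn hvn hconv hsmono f.toLinearMap
    have h1 := hfu _ (subset_convexHull ℝ _ ⟨k, i, h, rfl⟩)
    have hint := integral_vertexPath hn hvn hsmono h
    have hsi : IntegrableOn s (Set.Icc (-ℓ (v n)) (ℓ (v n))) := by
      rw [← himg]
      exact hs.1.integrableOn_compact (himg ▸ isCompact_Icc)
    have hpi : IntegrableOn (vertexPath v ℓ k i) (Set.Icc (-ℓ (v n)) (ℓ (v n))) :=
      (continuous_polygonalPath _ _ _).continuousOn.integrableOn_compact isCompact_Icc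
    have hle : f (∫ t in ℓ '' P, s t) ≤ (2 * ℓ (v n)) * f (averagedPathVector v ℓ n k i) := by
      rw [← smul_eq_mul, ← map_smul, ← hint, himg, ← f.integral_comp_comm hsi,
        ← f.integral_comp_comm hpi]
      refine setIntegral_mono_on (f.integrable_comp hsi) (f.integrable_comp hpi)
        measurableSet_Icc fun t ht => ?_
      have hst := hs.2 t (himg ▸ ht)
      -- The same path dominates `s` at every `t`, as `ℓ (s t) = t`.
      simpa [hst.2] using hmax (s t) hst.1
    simp only [map_smul, smul_eq_mul] at huf
    rw [← inv_mul_le_iff₀ hc] at hle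
    linarith
  · refine convexHull_mono ?_
    rintro _ ⟨k, i, h, rfl⟩
    refine ⟨_, ⟨_, isSectionOf_vertexPath hn hconv hsmono h, rfl⟩, ?_⟩
    simp only [himg]
    rw [integral_vertexPath hn hvn hsmono h, inv_smul_smul₀ hc.ne']
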